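/- Let $M$ be a triangulated piecewise flat surface (with or without boundary), that is, a simplicial complex triangulating a surface, with edge lengths that make each simplex a nondegenerate Euclidean simplex, equipped with the intrinsic distance $d_{g^\Delta}$ of the space obtained by gluing these simplices (the infimum of the lengths of broken lines whose segments each lie in a single simplex). A \emph{combinatorial closed disk} is a simplicial complex that triangulates a closed disk, i.e. a finite, connected, simply connected triangulated surface with nonempty boundary; it has \emph{generation} $m$ and is \emph{centered} at its vertex $v$ if every boundary vertex $w$ has distance exactly $m$ from $v$ in the unweighted graph of its vertices and edges. A Euclidean $n$-simplex $\sigma$ is \emph{$(\vartheta,\epsilon)$-full} if all its edges have length at most $\epsilon$ and $n!\,\mathrm{Vol}(\sigma)\ge\vartheta\epsilon^n$. Let $D_m\subset M$ be a subcomplex that is a combinatorial closed disk of generation $m$ centered at $v$, and suppose that every simplex of $D_m$ is $(\vartheta,\epsilon)$-full. Then the distance $\delta=d_{g^\Delta}(v,\partial D_m)$ from $v$ to the boundary of $D_m$ is finite and satisfies \[ \vartheta m\epsilon\le\delta\le m\epsilon. \] -/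

import Mathlib

open MeasureTheory
open scoped ENNReal Nat

noncomputable section

namespace PiecewiseFlat

variable {V : Type*} [DecidableEq V]

/-! ### Combinatorics of abstract simplicial complexes -/

/-- The graph formed by the vertices and edges of a simplicial complex. Elements of `V` that are
not vertices of `K` are isolated in it. -/
def edgeGraph (K : PreAbstractSimplicialComplex V) : SimpleGraph V where
  Adj a b := a ≠ b ∧ ({a, b} : Finset V) ∈ K
  symm := ⟨fun a b h => ⟨h.1.symm, by rw [Finset.pair_comm]; exact h.2⟩⟩
  loopless := ⟨fun _ h => h.1 rfl⟩

/-- The triangles of `K` that contain the simplex `e`. -/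
def trianglesOn (K : PreAbstractSimplicialComplex V) (e : Finset V) : Set (Finset V) :=
  {t | t ∈ K ∧ t.card = 3 ∧ e ⊆ t}

/-- The link of the vertex `v` as a graph: its vertices are the neighbours of `v`, and two of them
are joined if together with `v` they span a triangle. -/
def linkGraph (K : PreAbstractSimplicialComplex V) (v : V) :
    SimpleGraph ((edgeGraph K).neighborSet v) where
  Adj a b := a ≠ b ∧ ({v, a.1, b.1} : Finset V) ∈ K
  symm := ⟨fun a b h => ⟨h.1.symm, by rw [Finset.pair_comm]; exact h.2⟩⟩
  loopless := ⟨fun _ h => h.1 rfl⟩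

/-- A simplicial complex that triangulates a surface, with or without boundary and not necessarily
compact or connected: it has dimension at most two, each edge lies in one or two triangles, and
the link of each vertex is finite, nonempty and connected. Together these say that the link of each
vertex is a simple polygonal arc (with at least one edge) or a simple closed polygon. -/
structure IsTriangulatedSurface (K : PreAbstractSimplicialComplex V) : Prop where
  card_le : ∀ s ∈ K, s.card ≤ 3
  edge : ∀ e ∈ K, e.card = 2 → (trianglesOn K e).ncard = 1 ∨ (trianglesOn K e).ncard = 2
  link_finite : ∀ v, {v} ∈ K → ((edgeGraph K).neighborSet v).Finite
  link_connected : ∀ v, {v} ∈ K → (linkGraph K v).Connected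

/-- The boundary of a triangulated surface: the subcomplex formed by the edges that lie in exactly
one triangle, together with their vertices. -/
def boundary (K : PreAbstractSimplicialComplex V) : PreAbstractSimplicialComplex V where
  faces := {s | s.Nonempty ∧ ∃ e ∈ K, e.card = 2 ∧ (trianglesOn K e).ncard = 1 ∧ s ⊆ e}
  isRelLowerSet_faces := by
    rintro s ⟨hs, e, he, h2, h1, hse⟩
    exact ⟨hs, fun t hts ht => ⟨ht, e, he, h2, h1, hts.trans hse⟩⟩

/-! ### Geometric realization -/

/-- The closed simplex spanned by `s`, in barycentric coordinates. -/
def cell (s : Finset V) : Set (V → ℝ) :=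
  {x | (∀ a, 0 ≤ x a) ∧ (∀ a, a ∉ s → x a = 0) ∧ ∑ a ∈ s, x a = 1}

/-- The geometric realization of `K`, in barycentric coordinates. As a subspace of `V → ℝ` it
carries the usual topology if `K` is finite (the topology is only used in that case). -/
def realization (K : PreAbstractSimplicialComplex V) : Set (V → ℝ) :=
  ⋃ s ∈ K, cell s

/-- The vertex `v` as a point of the geometric realization. -/
def vertexPoint (v : V) : V → ℝ := Pi.single v 1

/-- A combinatorial closed disk: a triangulated surface that is finite, connected, simply
connected, and has nonempty boundary. -/
structure IsClosedDisk (D : PreAbstractSimplicialComplex V) : Prop where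
  surface : IsTriangulatedSurface D
  finite : D.faces.Finite
  connected : ∀ a b, {a} ∈ D → {b} ∈ D → (edgeGraph D).Reachable a b
  simplyConnected : SimplyConnectedSpace (realization D)
  boundary_nonempty : (boundary D).faces.Nonempty

/-- A combinatorial closed disk of generation `m` centered at `v`: every boundary vertex is at
combinatorial distance exactly `m` from `v`. -/
structure IsClosedDiskOfGeneration (D : PreAbstractSimplicialComplex V) (m : ℕ) (v : V) :
    Prop where
  disk : IsClosedDisk D
  center_mem : {v} ∈ D
  dist_eq : ∀ w, {w} ∈ boundary D → (edgeGraph D).dist v w = m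

/-! ### Piecewise flat geometry -/

/-- `p` places the vertices of `s` in Euclidean space of dimension `s.card - 1` as the vertices of
a nondegenerate simplex with edge lengths `ℓ`. -/
def IsEuclideanModel (ℓ : V → V → ℝ) (s : Finset V)
    (p : s → EuclideanSpace ℝ (Fin (s.card - 1))) : Prop :=
  AffineIndependent ℝ p ∧ ∀ a b : s, dist (p a) (p b) = ℓ a b

/-- The edge lengths `ℓ` make `s` a nondegenerate Euclidean simplex. -/
def IsEuclidean (ℓ : V → V → ℝ) (s : Finset V) : Prop :=
  ∃ p, IsEuclideanModel ℓ s p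

/-- The simplex `s`, of dimension `n = s.card - 1`, with edge lengths `ℓ` is Euclidean and
`(ϑ, ε)`-full: all its edges have length at most `ε`, and its `n`-dimensional volume satisfies
`n! * Vol ≥ ϑ * ε ^ n`. Euclidean models of `s` are unique up to isometry, so that the volume does
not depend on the choice of the model. -/
def IsEuclideanFull (ℓ : V → V → ℝ) (ϑ ε : ℝ) (s : Finset V) : Prop :=
  (∀ a ∈ s, ∀ b ∈ s, a ≠ b → ℓ a b ≤ ε) ∧
    ∃ p, IsEuclideanModel ℓ s p ∧
      ϑ * ε ^ (s.card - 1) ≤ ((s.card - 1)! : ℝ) * volume.real (convexHull ℝ (Set.range p))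

/-- A triangulated piecewise flat surface: a triangulated surface with edge lengths that make each
simplex a nondegenerate Euclidean simplex. -/
structure IsPiecewiseFlatSurface (K : PreAbstractSimplicialComplex V) (ℓ : V → V → ℝ) :
    Prop where
  surface : IsTriangulatedSurface K
  euclidean : ∀ s ∈ K, IsEuclidean ℓ s

/-- The Euclidean distance, inside the simplex `s` with edge lengths `ℓ`, between the points with
barycentric coordinates `x` and `y`: the norm of `x - y` for the flat metric
`⟨u, w⟩ = - 1/2 * ∑ a b, ℓ a b ^ 2 * u a * w b` on vectors with coordinate sum zero. -/
def simplexDist (ℓ : V → V → ℝ) (s : Finset V) (x y : V → ℝ) : ℝ :=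
  Real.sqrt (-(1 / 2) * ∑ a ∈ s, ∑ b ∈ s, ℓ a b ^ 2 * (x a - y a) * (x b - y b))

/-- `q 0, …, q n` are the successive corners of a broken line from `x` to `y` in the realization of
`K` whose `i`-th segment lies in the closed simplex `s i` of `K`. -/
structure IsBrokenLine (K : PreAbstractSimplicialComplex V) (x y : V → ℝ) (n : ℕ)
    (q : ℕ → V → ℝ) (s : ℕ → Finset V) : Prop where
  mem : x ∈ realization K
  start : q 0 = x
  finish : q n = y
  face : ∀ i < n, s i ∈ K
  left_mem : ∀ i < n, q i ∈ cell (s i)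
  right_mem : ∀ i < n, q (i + 1) ∈ cell (s i)

/-- The piecewise flat distance, i.e. the intrinsic distance of the space glued from the Euclidean
simplices of `K`: the infimum of the lengths of broken lines from `x` to `y`
(infinite if there are none). -/
def flatDist (K : PreAbstractSimplicialComplex V) (ℓ : V → V → ℝ) (x y : V → ℝ) : ℝ≥0∞ :=
  ⨅ (n : ℕ) (q : ℕ → V → ℝ) (s : ℕ → Finset V) (_ : IsBrokenLine K x y n q s),
    ∑ i ∈ Finset.range n, ENNReal.ofReal (simplexDist ℓ (s i) (q i) (q (i + 1)))

/-- The piecewise flat distance from a point `x` to a set `S`. -/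
def flatInfDist (K : PreAbstractSimplicialComplex V) (ℓ : V → V → ℝ) (x : V → ℝ)
    (S : Set (V → ℝ)) : ℝ≥0∞ :=
  ⨅ y ∈ S, flatDist K ℓ x y

end PiecewiseFlat

end

noncomputable section

namespace PiecewiseFlat

/-! ### The area of a plane triangle -/

/-- The standard plane triangle has area at most (in fact, exactly) one half. -/
lemma volume_standardTriangle_le :
    volume {x : EuclideanSpace ℝ (Fin 2) | 0 ≤ x 0 ∧ 0 ≤ x 1 ∧ x 0 + x 1 ≤ 1} ≤
      ENNReal.ofReal (1 / 2) := by
  set S : Set (ℝ × ℝ) := {x | 0 ≤ x.1 ∧ 0 ≤ x.2 ∧ x.1 + x.2 ≤ 1}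
  have hS : MeasurableSet S := by
    have h1 : IsClosed {x : ℝ × ℝ | 0 ≤ x.1} := isClosed_le (by fun_prop) (by fun_prop)
    have h2 : IsClosed {x : ℝ × ℝ | 0 ≤ x.2} := isClosed_le (by fun_prop) (by fun_prop)
    have h3 : IsClosed {x : ℝ × ℝ | x.1 + x.2 ≤ 1} := isClosed_le (by fun_prop) (by fun_prop)
    exact (h1.inter (h2.inter h3)).measurableSet
  have hpre : {x : EuclideanSpace ℝ (Fin 2) | 0 ≤ x 0 ∧ 0 ≤ x 1 ∧ x 0 + x 1 ≤ 1} =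
      (fun x => MeasurableEquiv.finTwoArrow (WithLp.ofLp x)) ⁻¹' S := by
    ext x; simp [S, MeasurableEquiv.finTwoArrow]
  have hmp := (volume_preserving_finTwoArrow ℝ).comp (PiLp.volume_preserving_ofLp (Fin 2))
  rw [hpre]
  refine (hmp.measure_preimage hS.nullMeasurableSet).trans_le ?_
  rw [Measure.volume_eq_prod, Measure.prod_apply hS]
  have hle : ∀ x : ℝ, volume (Prod.mk x ⁻¹' S) ≤
      (Set.Icc (0 : ℝ) 1).indicator (fun x => ENNReal.ofReal (1 - x)) x := by
    intro x
    by_cases hx : x ∈ Set.Icc (0 : ℝ) 1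
    · rw [Set.indicator_of_mem hx]
      refine (measure_mono (t := Set.Icc 0 (1 - x)) ?_).trans (by simp)
      rintro y ⟨-, h1, h2⟩
      exact ⟨h1, by simp only at h2; linarith⟩
    · have : Prod.mk x ⁻¹' S = ∅ := by
        ext y
        simp only [S, Set.mem_preimage, Set.mem_ofPred_eq, Set.mem_empty_iff_false, iff_false]
        rintro ⟨h1, h2, h3⟩
        exact hx ⟨h1, by linarith⟩
      simp [this]
  refine (lintegral_mono hle).trans ?_
  rw [lintegral_indicator measurableSet_Icc, ← ofReal_integral_eq_lintegral_ofReal]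
  · rw [integral_Icc_eq_integral_Ioc, ← intervalIntegral.integral_of_le zero_le_one]
    apply ENNReal.ofReal_le_ofReal
    rw [intervalIntegral.integral_sub (by simp) (by simp)]
    norm_num
  · exact Continuous.integrableOn_Icc (by fun_prop)
  · filter_upwards [ae_restrict_mem measurableSet_Icc] with x hx
    simpa using hx.2

/-- Twice the area of a plane triangle is at most the determinant of two of its sides. -/
lemma two_mul_volume_triangle_le (p₀ p₁ p₂ : EuclideanSpace ℝ (Fin 2)) :
    2 * volume.real (convexHull ℝ {p₀, p₁, p₂}) ≤
      |(p₁ 0 - p₀ 0) * (p₂ 1 - p₀ 1) - (p₁ 1 - p₀ 1) * (p₂ 0 - p₀ 0)| := by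
  set A : Matrix (Fin 2) (Fin 2) ℝ :=
    !![p₁ 0 - p₀ 0, p₂ 0 - p₀ 0; p₁ 1 - p₀ 1, p₂ 1 - p₀ 1]
  set b := (EuclideanSpace.basisFun (Fin 2) ℝ).toBasis
  set L : EuclideanSpace ℝ (Fin 2) →ₗ[ℝ] EuclideanSpace ℝ (Fin 2) := Matrix.toLin b b A
  have hL : ∀ x, L x = x 0 • (p₁ - p₀) + x 1 • (p₂ - p₀) := by
    intro x
    ext i
    fin_cases i <;>
      simp [L, b, A, Matrix.toLin_apply, Matrix.mulVec, dotProduct, Fin.sum_univ_two] <;> ring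
  have hdet : LinearMap.det L =
      (p₁ 0 - p₀ 0) * (p₂ 1 - p₀ 1) - (p₁ 1 - p₀ 1) * (p₂ 0 - p₀ 0) := by
    rw [LinearMap.det_toLin, Matrix.det_fin_two_of]; ring
  set S := {x : EuclideanSpace ℝ (Fin 2) | 0 ≤ x 0 ∧ 0 ≤ x 1 ∧ x 0 + x 1 ≤ 1}
  have hsub : convexHull ℝ {p₀, p₁, p₂} ⊆ (fun y => p₀ + y) '' (L '' S) := by
    intro z hz
    rw [convexHull_insert (by simp), convexHull_pair] at hz
    simp only [segment_eq_image, mem_convexJoin, Set.mem_singleton_iff,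
      exists_eq_left, Set.mem_image, exists_exists_and_eq_and] at hz
    obtain ⟨s, hs, t, ht, rfl⟩ := hz
    have h0 := mul_nonneg ht.1 (sub_nonneg.2 hs.2)
    have h1 := mul_nonneg ht.1 hs.1
    refine ⟨_, ⟨!₂[t * (1 - s), t * s], ⟨by simpa using h0, by simpa using h1, ?_⟩, rfl⟩, ?_⟩
    · simp; linarith [ht.2]
    · simp only [hL]
      ext i
      simp
      ring
  have hvol : volume (convexHull ℝ {p₀, p₁, p₂}) ≤
      ENNReal.ofReal |LinearMap.det L| * ENNReal.ofReal (1 / 2) := by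
    refine (measure_mono hsub).trans ?_
    rw [Set.image_add_left, measure_preimage_add, Measure.addHaar_image_linearMap]
    gcongr
    exact volume_standardTriangle_le
  have := ENNReal.toReal_mono (by finiteness) hvol
  rw [ENNReal.toReal_mul, ENNReal.toReal_ofReal (abs_nonneg _),
    ENNReal.toReal_ofReal (by norm_num), hdet] at this
  rw [Measure.real]
  linarith

/-- A displacement with component `α` along one side issuing from the vertex `p₁` has length at
least `|α|` times the altitude onto the other side. -/
lemma two_mul_volume_triangle_mul_abs_le {n : ℕ} (hn : n = 2)
    (p₀ p₁ p₂ : EuclideanSpace ℝ (Fin n)) (α β : ℝ) :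
    2 * volume.real (convexHull ℝ {p₀, p₁, p₂}) * |α| ≤
      ‖α • (p₀ - p₁) + β • (p₂ - p₁)‖ * ‖p₂ - p₁‖ := by
  subst hn
  refine (mul_le_mul_of_nonneg_right (two_mul_volume_triangle_le p₀ p₁ p₂)
    (abs_nonneg α)).trans ?_
  rw [EuclideanSpace.norm_eq, EuclideanSpace.norm_eq, ← Real.sqrt_mul (by positivity), ← abs_mul]
  apply Real.abs_le_sqrt
  simp only [Fin.sum_univ_two, Real.norm_eq_abs, sq_abs, PiLp.add_apply, PiLp.sub_apply,
    PiLp.smul_apply, smul_eq_mul]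
  have := sq_nonneg ((α * (p₀ 0 - p₁ 0) + β * (p₂ 0 - p₁ 0)) * (p₂ 0 - p₁ 0) +
    (α * (p₀ 1 - p₁ 1) + β * (p₂ 1 - p₁ 1)) * (p₂ 1 - p₁ 1))
  linarith

end PiecewiseFlat
end

noncomputable section

namespace PiecewiseFlat

variable {V : Type*}

/-! ### Distances inside a simplex -/

/-- The distance inside a simplex may be computed in any larger simplex. -/
lemma simplexDist_of_subset (ℓ : V → V → ℝ) {s t : Finset V} (hst : s ⊆ t) {x y : V → ℝ}
    (hx : x ∈ cell s) (hy : y ∈ cell s) : simplexDist ℓ s x y = simplexDist ℓ t x y := by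
  have h0 : ∀ a, a ∉ s → x a - y a = 0 := fun a ha => by rw [hx.2.1 a ha, hy.2.1 a ha, sub_zero]
  unfold simplexDist
  congr 2
  rw [← Finset.sum_subset hst fun a _ ha => Finset.sum_eq_zero fun b _ => by rw [h0 a ha]; ring]
  exact Finset.sum_congr rfl fun a _ =>
    Finset.sum_subset hst fun b _ hb => by rw [h0 b hb, mul_zero]

lemma cell_mono {s t : Finset V} (hst : s ⊆ t) : cell s ⊆ cell t := by
  intro x hx
  refine ⟨hx.1, fun a ha => hx.2.1 a fun h => ha (hst h), ?_⟩
  rw [← Finset.sum_subset hst fun a _ ha => hx.2.1 a ha]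
  exact hx.2.2

/-- In a Euclidean realization of a simplex, `simplexDist` is the Euclidean distance. -/
lemma simplexDist_eq_norm {E : Type*} [NormedAddCommGroup E] [InnerProductSpace ℝ E]
    {ℓ : V → V → ℝ} {s : Finset V} {P : V → E} (hP : ∀ a ∈ s, ∀ b ∈ s, dist (P a) (P b) = ℓ a b)
    {x y : V → ℝ} (hx : x ∈ cell s) (hy : y ∈ cell s) :
    simplexDist ℓ s x y = ‖∑ a ∈ s, (x a - y a) • P a‖ := by
  have h0 : ∑ a ∈ s, (x a - y a) = 0 := by rw [Finset.sum_sub_distrib, hx.2.2, hy.2.2, sub_self]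
  rw [simplexDist, norm_eq_sqrt_real_inner, inner_sum_smul_sum_smul_of_sum_eq_zero P h0 P h0,
    neg_div, neg_mul, one_div_mul_eq_div]
  congr 3
  refine Finset.sum_congr rfl fun a ha => Finset.sum_congr rfl fun b hb => ?_
  rw [← hP a ha b hb, dist_eq_norm]
  ring

variable [DecidableEq V]

lemma IsEuclideanModel.exists_extension {ℓ : V → V → ℝ} {s : Finset V}
    {p : s → EuclideanSpace ℝ (Fin (s.card - 1))} (hp : IsEuclideanModel ℓ s p) :
    ∃ P : V → EuclideanSpace ℝ (Fin (s.card - 1)),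
      (∀ a ∈ s, ∀ b ∈ s, dist (P a) (P b) = ℓ a b) ∧ Set.range p = P '' s := by
  refine ⟨fun a => if h : a ∈ s then p ⟨a, h⟩ else 0, fun a ha b hb => ?_, ?_⟩
  · simpa [ha, hb] using hp.2 ⟨a, ha⟩ ⟨b, hb⟩
  · ext z
    constructor
    · rintro ⟨a, rfl⟩
      exact ⟨a, a.2, by simp⟩
    · rintro ⟨a, ha, rfl⟩
      have ha' : a ∈ s := ha
      exact ⟨⟨a, ha'⟩, by simp [ha']⟩

/-- In a full triangle, the barycentric coordinate of a vertex varies at most by `1 / (ϑ * ε)` times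
the distance, since the altitude from that vertex is at least `ϑ * ε`. -/
lemma IsEuclideanFull.mul_abs_sub_le {ℓ : V → V → ℝ} {ϑ ε : ℝ} (hε : 0 < ε) {a b c : V}
    (hab : a ≠ b) (hac : a ≠ c) (hbc : b ≠ c) (h : IsEuclideanFull ℓ ϑ ε {a, b, c})
    {x y : V → ℝ} (hx : x ∈ cell {a, b, c}) (hy : y ∈ cell {a, b, c}) :
    ϑ * ε * |x a - y a| ≤ simplexDist ℓ {a, b, c} x y := by
  obtain ⟨hle, p, hp, hvol⟩ := h
  obtain ⟨P, hP, hrange⟩ := hp.exists_extension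
  have hcard : ({a, b, c} : Finset V).card - 1 = 2 := by
    rw [Finset.card_eq_three.2 ⟨a, b, c, hab, hac, hbc, rfl⟩]
  have hpow : ε ^ (({a, b, c} : Finset V).card - 1) = ε ^ 2 := by rw [hcard]
  have hfac : (((({a, b, c} : Finset V).card - 1)! : ℕ) : ℝ) = 2 := by rw [hcard]; norm_num
  have himage : P '' ({a, b, c} : Finset V) = {P a, P b, P c} := by
    simp [Set.image_insert_eq]
  rw [hrange, himage, hpow, hfac] at hvol
  have key := two_mul_volume_triangle_mul_abs_le hcard (P a) (P b) (P c) (x a - y a) (x c - y c)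
  rw [simplexDist_eq_norm hP hx hy]
  have hsx := hx.2.2
  have hsy := hy.2.2
  have hexp : ∀ {E : Type} [AddCommMonoid E] (f : V → E),
      ∑ i ∈ ({a, b, c} : Finset V), f i = f a + f b + f c := by
    intro E _ f
    rw [Finset.sum_insert (by simp [hab, hac]), Finset.sum_pair hbc, add_assoc]
  rw [hexp] at hsx hsy
  have hvec : ∑ i ∈ ({a, b, c} : Finset V), (x i - y i) • P i =
      (x a - y a) • (P a - P b) + (x c - y c) • (P c - P b) := by
    rw [hexp, show x b - y b = -(x a - y a) - (x c - y c) by linarith]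
    module
  rw [hvec]
  set N := ‖(x a - y a) • (P a - P b) + (x c - y c) • (P c - P b)‖
  have hside : ‖P c - P b‖ ≤ ε := by
    rw [← dist_eq_norm, hP c (by simp) b (by simp)]
    exact hle c (by simp) b (by simp) hbc.symm
  have h1 : N * ‖P c - P b‖ ≤ N * ε := mul_le_mul_of_nonneg_left hside (norm_nonneg _)
  have h2 := mul_le_mul_of_nonneg_right hvol (abs_nonneg (x a - y a))
  refine le_of_mul_le_mul_right ?_ hε
  calc ϑ * ε * |x a - y a| * ε = ϑ * ε ^ 2 * |x a - y a| := by ring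
    _ ≤ N * ε := h2.trans (key.trans h1)

/-- A function on the vertices of a full triangle whose values at two vertices agree and at the
third differ at most by one, extended linearly, is `1 / (ϑ * ε)`-Lipschitz. -/
lemma IsEuclideanFull.mul_sub_le_of_eq {ℓ : V → V → ℝ} {ϑ ε : ℝ} (hε : 0 < ε) (hϑ : 0 ≤ ϑ)
    {a b c : V} (hab : a ≠ b) (hac : a ≠ c) (hbc : b ≠ c) {t : Finset V} (ht : t = {a, b, c})
    (h : IsEuclideanFull ℓ ϑ ε t) {x y : V → ℝ} (hx : x ∈ cell t) (hy : y ∈ cell t)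
    {g : V → ℝ} (hgbc : g b = g c) (hg : |g a - g b| ≤ 1) :
    ϑ * ε * (∑ i ∈ t, g i * y i - ∑ i ∈ t, g i * x i) ≤ simplexDist ℓ t x y := by
  subst ht
  refine le_trans ?_ (h.mul_abs_sub_le hε hab hac hbc hx hy)
  refine mul_le_mul_of_nonneg_left ?_ (by positivity)
  have hsx := hx.2.2
  have hsy := hy.2.2
  have hexp : ∀ f : V → ℝ, ∑ i ∈ ({a, b, c} : Finset V), f i = f a + f b + f c := by
    intro f
    rw [Finset.sum_insert (by simp [hab, hac]), Finset.sum_pair hbc, add_assoc]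
  rw [hexp] at hsx hsy
  rw [hexp, hexp, ← hgbc]
  calc _ = (g a - g b) * (y a - x a) + g b * ((y a + y b + y c) - (x a + x b + x c)) := by ring
    _ = (g a - g b) * (y a - x a) := by rw [hsx, hsy]; ring
    _ ≤ |g a - g b| * |y a - x a| := by rw [← abs_mul]; exact le_abs_self _
    _ ≤ |x a - y a| := by
      rw [abs_sub_comm (y a)]
      exact mul_le_of_le_one_left (abs_nonneg _) hg

/-- An integral function on the vertices of a full triangle whose values differ pairwise at most by
one, extended linearly, is `1 / (ϑ * ε)`-Lipschitz. -/
lemma IsEuclideanFull.mul_sub_le {ℓ : V → V → ℝ} {ϑ ε : ℝ} (hε : 0 < ε) (hϑ : 0 ≤ ϑ)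
    {t : Finset V} (ht : t.card = 3) (h : IsEuclideanFull ℓ ϑ ε t) {x y : V → ℝ}
    (hx : x ∈ cell t) (hy : y ∈ cell t) {d : V → ℕ} (hd : ∀ a ∈ t, ∀ b ∈ t, d a ≤ d b + 1) :
    ϑ * ε * (∑ i ∈ t, d i * y i - ∑ i ∈ t, d i * x i) ≤ simplexDist ℓ t x y := by
  obtain ⟨a, b, c, hab, hac, hbc, habc⟩ := Finset.card_eq_three.1 ht
  have habs : ∀ i ∈ t, ∀ j ∈ t, |(d i : ℝ) - d j| ≤ 1 := by
    intro i hi j hj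
    have h1 : (d i : ℝ) ≤ d j + 1 := by exact_mod_cast hd i hi j hj
    have h2 : (d j : ℝ) ≤ d i + 1 := by exact_mod_cast hd j hj i hi
    rw [abs_le]
    constructor <;> linarith
  have ha : a ∈ t := by simp [habc]
  have hb : b ∈ t := by simp [habc]
  have hc : c ∈ t := by simp [habc]
  have hpig : d b = d c ∨ d a = d c ∨ d a = d b := by
    have := hd a ha b hb; have := hd b hb a ha; have := hd a ha c hc
    have := hd c hc a ha; have := hd b hb c hc; have := hd c hc b hb
    omega
  rcases hpig with he | he | he
  · exact h.mul_sub_le_of_eq hε hϑ hab hac hbc habc hx hy (g := fun i => d i)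
      (by simp [he]) (habs a ha b hb)
  · exact h.mul_sub_le_of_eq hε hϑ hab.symm hbc hac (by rw [habc, Finset.insert_comm]) hx hy
      (g := fun i => d i) (by simp [he]) (habs b hb a ha)
  · exact h.mul_sub_le_of_eq hε hϑ hac.symm hbc.symm hab
      (by rw [habc, Finset.pair_comm b c, Finset.insert_comm]) hx hy
      (g := fun i => d i) (by simp [he]) (habs c hc a ha)

end PiecewiseFlat
end

noncomputable section

namespace PiecewiseFlat

variable {V : Type*}

/-! ### Faces -/

lemma mem_of_subset_of_nonempty {K : PreAbstractSimplicialComplex V} {s t : Finset V} (hs : s ∈ K)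
    (hts : t ⊆ s) (ht : t.Nonempty) : t ∈ K :=
  (K.isRelLowerSet_faces hs).2 hts ht

/-- The vertices at which a point of a simplex has positive coordinates span a face that contains
the point, and is contained in every simplex that contains the point. -/
lemma exists_carrier {s : Finset V} {x : V → ℝ} (hx : x ∈ cell s) :
    ∃ t : Finset V, t.Nonempty ∧ x ∈ cell t ∧ ∀ s', x ∈ cell s' → t ⊆ s' := by
  classical
  have hsum : ∑ a ∈ s with x a ≠ 0, x a = 1 := by rw [Finset.sum_filter_ne_zero, hx.2.2]
  refine ⟨s.filter fun a => x a ≠ 0, ?_, ⟨hx.1, ?_, hsum⟩, ?_⟩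
  · by_contra h
    rw [Finset.not_nonempty_iff_eq_empty.1 h, Finset.sum_empty] at hsum
    exact zero_ne_one hsum
  · intro a ha
    by_contra h
    by_cases has : a ∈ s
    · exact ha (Finset.mem_filter.2 ⟨has, h⟩)
    · exact h (hx.2.1 a has)
  · intro s' hs' a ha
    by_contra h
    exact (Finset.mem_filter.1 ha).2 (hs'.2.1 a h)

lemma IsEuclidean.length_pos {ℓ : V → V → ℝ} {a b : V} {s : Finset V} (h : IsEuclidean ℓ s)
    (ha : a ∈ s) (hb : b ∈ s) (hab : a ≠ b) : 0 < ℓ a b := by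
  obtain ⟨p, hp, hd⟩ := h
  rw [← hd ⟨a, ha⟩ ⟨b, hb⟩, dist_pos]
  exact fun h => hab (congrArg Subtype.val (hp.injective h))

/-! ### Linear extension of functions on the vertices -/

/-- The extension to the realization, linear on each simplex, of a function on the vertices. -/
def linearExtension (d : V → ℕ) (x : V → ℝ) : ℝ :=
  ∑ᶠ a, d a * x a

lemma linearExtension_eq_sum (d : V → ℕ) {s : Finset V} {x : V → ℝ} (hx : x ∈ cell s) :
    linearExtension d x = ∑ a ∈ s, d a * x a := by
  refine finsum_eq_sum_of_support_subset _ fun a ha => ?_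
  by_contra h
  exact ha (by simp only [hx.2.1 a h, mul_zero])

/-- The linear extension of a function that is constant on the vertices of a complex. -/
lemma linearExtension_eq_of_mem_realization {K : PreAbstractSimplicialComplex V} {d : V → ℕ}
    {m : ℕ} (hd : ∀ w, {w} ∈ K → d w = m) {x : V → ℝ} (hx : x ∈ realization K) :
    linearExtension d x = m := by
  simp only [realization, Set.mem_iUnion, exists_prop] at hx
  obtain ⟨s, hs, hxs⟩ := hx
  have hc : ∀ a ∈ s, (d a : ℝ) * x a = m * x a := fun a ha => by
    rw [hd a (mem_of_subset_of_nonempty hs (by simpa using ha) (by simp))]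
  rw [linearExtension_eq_sum d hxs, Finset.sum_congr rfl hc, ← Finset.mul_sum, hxs.2.2, mul_one]

variable [DecidableEq V]

/-! ### Subsurfaces -/

lemma IsTriangulatedSurface.exists_edge {K : PreAbstractSimplicialComplex V}
    (hK : IsTriangulatedSurface K) {u : V} (hu : {u} ∈ K) : ∃ b, (edgeGraph K).Adj u b :=
  let ⟨b⟩ := (hK.link_connected u hu).nonempty
  ⟨b.1, b.2⟩

lemma IsTriangulatedSurface.exists_triangle_of_edge {K : PreAbstractSimplicialComplex V}
    (hK : IsTriangulatedSurface K) {e : Finset V} (he : e ∈ K) (h2 : e.card = 2) :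
    ∃ t ∈ K, t.card = 3 ∧ e ⊆ t :=
  Set.nonempty_of_ncard_ne_zero (s := trianglesOn K e) (by have := hK.edge e he h2; omega)

lemma IsTriangulatedSurface.exists_triangle {K : PreAbstractSimplicialComplex V}
    (hK : IsTriangulatedSurface K) {s : Finset V} (hs : s ∈ K) :
    ∃ t ∈ K, t.card = 3 ∧ s ⊆ t := by
  have h0 : s.card ≠ 0 := (Finset.card_pos.2 (K.isRelLowerSet_faces hs).1).ne'
  have h3 := hK.card_le s hs
  obtain h | h | h : s.card = 1 ∨ s.card = 2 ∨ s.card = 3 := by omega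
  · obtain ⟨u, rfl⟩ := Finset.card_eq_one.1 h
    obtain ⟨b, hub, hb⟩ := hK.exists_edge hs
    obtain ⟨t, ht, htc, hsub⟩ := hK.exists_triangle_of_edge hb (Finset.card_pair hub)
    exact ⟨t, ht, htc, fun a ha => hsub (by simp_all)⟩
  · exact hK.exists_triangle_of_edge hs h
  · exact ⟨s, hs, h, subset_rfl⟩

section Subsurface

variable {M D : PreAbstractSimplicialComplex V}

/-- A triangle of the surface on an edge interior to a subsurface belongs to the subsurface. -/
lemma IsTriangulatedSurface.mem_of_edge_notMem_boundary (hM : IsTriangulatedSurface M)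
    (hD : IsTriangulatedSurface D) (hDM : D ≤ M) {e s : Finset V} (he : e ∈ D) (h2 : e.card = 2)
    (heb : e ∉ boundary D) (hs : s ∈ M) (h3 : s.card = 3) (hes : e ⊆ s) : s ∈ D := by
  have hne : (trianglesOn D e).ncard ≠ 1 := fun h =>
    heb ⟨Finset.card_pos.1 (by omega), e, he, h2, h, subset_rfl⟩
  have hDe := hD.edge e he h2
  have hMe := hM.edge e (hDM he) h2
  have hsub : trianglesOn D e ⊆ trianglesOn M e := fun t ht => ⟨hDM ht.1, ht.2⟩
  have heq := Set.eq_of_subset_of_ncard_le hsub (by omega)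
    (Set.finite_of_ncard_ne_zero (by omega))
  have hmem : s ∈ trianglesOn D e := heq ▸ ⟨hs, h3, hes⟩
  exact hmem.1

/-- A subsurface contains every edge of the surface at an interior vertex. -/
lemma IsTriangulatedSurface.edge_mem_of_notMem_boundary (hM : IsTriangulatedSurface M)
    (hD : IsTriangulatedSurface D) (hDM : D ≤ M) {u b : V} (hu : {u} ∈ D)
    (hub : {u} ∉ boundary D) (hb : (edgeGraph M).Adj u b) : {u, b} ∈ D := by
  obtain ⟨b₀, hne₀, hb₀⟩ := hD.exists_edge hu
  have hstep : ∀ (a c : (edgeGraph M).neighborSet u), (linkGraph M u).Walk a c →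
      ({u, a.1} : Finset V) ∈ D → ({u, c.1} : Finset V) ∈ D := by
    intro a c w
    induction w with
    | nil => exact id
    | @cons a b' c hadj _ ih =>
      intro ha
      refine ih ?_
      have hua : u ≠ a.1 := a.2.1
      have hub' : u ≠ b'.1 := b'.2.1
      have hab : a.1 ≠ b'.1 := fun h => hadj.1 (Subtype.ext h)
      have ht : ({u, a.1, b'.1} : Finset V) ∈ D := by
        refine hM.mem_of_edge_notMem_boundary hD hDM ha (Finset.card_pair hua) ?_ hadj.2
          (Finset.card_eq_three.2 ⟨_, _, _, hua, hub', hab, rfl⟩) ?_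
        · exact fun h => hub (mem_of_subset_of_nonempty h (by simp) (by simp))
        · intro z; simp; tauto
      exact mem_of_subset_of_nonempty ht (by intro z; simp; tauto) (by simp)
  obtain ⟨w⟩ := (hM.link_connected u (hDM hu)).preconnected ⟨b₀, hne₀, hDM hb₀⟩ ⟨b, hb⟩
  exact hstep _ _ w hb₀

/-- A point of a subsurface that lies in a simplex outside the subsurface is a boundary point. -/
lemma IsTriangulatedSurface.mem_realization_boundary (hM : IsTriangulatedSurface M)
    (hD : IsTriangulatedSurface D) (hDM : D ≤ M) {x : V → ℝ} (hx : x ∈ realization D)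
    {s : Finset V} (hs : s ∈ M) (hsD : s ∉ D) (hxs : x ∈ cell s) :
    x ∈ realization (boundary D) := by
  obtain ⟨t, htne, hxt, hmin⟩ := exists_carrier hxs
  simp only [realization, Set.mem_iUnion, exists_prop] at hx ⊢
  obtain ⟨s', hs', hxs'⟩ := hx
  have htD : t ∈ D := mem_of_subset_of_nonempty hs' (hmin _ hxs') htne
  refine ⟨t, ?_, hxt⟩
  by_contra htb
  refine hsD ?_
  have hts : t ⊂ s := lt_of_le_of_ne (hmin _ hxs) fun h => hsD (h ▸ htD)
  have hcard := Finset.card_lt_card hts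
  have hcard0 := Finset.card_pos.2 htne
  have hcard3 := hM.card_le s hs
  obtain h1 | h2 : t.card = 1 ∨ t.card = 2 := by omega
  · obtain ⟨u, rfl⟩ := Finset.card_eq_one.1 h1
    have hus : u ∈ s := hts.1 (by simp)
    obtain ⟨b, hbs, hbu⟩ := Finset.exists_mem_ne (by omega : 1 < s.card) u
    have hsub : ({u, b} : Finset V) ⊆ s := by
      intro z hz
      simp only [Finset.mem_insert, Finset.mem_singleton] at hz
      rcases hz with rfl | rfl <;> assumption
    have hubD : ({u, b} : Finset V) ∈ D := hM.edge_mem_of_notMem_boundary hD hDM htD htb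
      ⟨hbu.symm, mem_of_subset_of_nonempty hs hsub (by simp)⟩
    obtain h | h : s.card = 2 ∨ s.card = 3 := by omega
    · rwa [← Finset.eq_of_subset_of_card_le hsub (by rw [Finset.card_pair hbu.symm, h])]
    · exact hM.mem_of_edge_notMem_boundary hD hDM hubD (Finset.card_pair hbu.symm)
        (fun h => htb (mem_of_subset_of_nonempty h (by simp) (by simp))) hs h hsub
  · exact hM.mem_of_edge_notMem_boundary hD hDM htD h2 htb hs (by omega) hts.1

end Subsurface

/-! ### Upper bound: walks along edges -/

lemma vertexPoint_mem_cell {a : V} {s : Finset V} (ha : a ∈ s) : vertexPoint a ∈ cell s := by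
  refine ⟨fun b => ?_, fun b hb => ?_, ?_⟩
  · by_cases h : b = a <;> simp [vertexPoint, h]
  · have : b ≠ a := fun h => hb (h ▸ ha)
    simp [vertexPoint, this]
  · simp [vertexPoint, Pi.single_apply, ha]

/-- The distance between the end points of an edge is its length. -/
lemma IsEuclidean.simplexDist_vertexPoint {ℓ : V → V → ℝ} {a b : V} (hab : a ≠ b)
    (h : IsEuclidean ℓ {a, b}) :
    simplexDist ℓ {a, b} (vertexPoint a) (vertexPoint b) = ℓ a b := by
  obtain ⟨p, hp⟩ := h
  obtain ⟨P, hP, -⟩ := hp.exists_extension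
  rw [simplexDist_eq_norm hP (vertexPoint_mem_cell (by simp)) (vertexPoint_mem_cell (by simp)),
    Finset.sum_pair hab, ← hP a (by simp) b (by simp), dist_eq_norm]
  simp [vertexPoint, hab, hab.symm, sub_eq_add_neg]

lemma flatDist_le_of_walk {M D : PreAbstractSimplicialComplex V} (hDM : D ≤ M) {ℓ : V → V → ℝ}
    {ε : ℝ} (hE : ∀ s ∈ D, IsEuclidean ℓ s) (hℓ : ∀ a b, (edgeGraph D).Adj a b → ℓ a b ≤ ε)
    {v w : V} (hv : {v} ∈ D) (p : (edgeGraph D).Walk v w) :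
    flatDist M ℓ (vertexPoint v) (vertexPoint w) ≤ p.length * ENNReal.ofReal ε := by
  have hline : IsBrokenLine M (vertexPoint v) (vertexPoint w) p.length
      (fun i => vertexPoint (p.getVert i)) (fun i => {p.getVert i, p.getVert (i + 1)}) :=
    { mem := Set.mem_biUnion (hDM hv) (vertexPoint_mem_cell (by simp))
      start := by simp
      finish := by simp
      face := fun i hi => hDM (p.adj_getVert_succ hi).2
      left_mem := fun i _ => vertexPoint_mem_cell (by simp)
      right_mem := fun i _ => vertexPoint_mem_cell (by simp) }
  refine iInf_le_of_le _ <| iInf_le_of_le _ <| iInf_le_of_le _ <| iInf_le_of_le hline ?_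
  refine (Finset.sum_le_card_nsmul _ _ (ENNReal.ofReal ε) fun i hi => ?_).trans (by simp)
  have hadj := p.adj_getVert_succ (Finset.mem_range.1 hi)
  rw [(hE _ hadj.2).simplexDist_vertexPoint hadj.1]
  exact ENNReal.ofReal_le_ofReal (hℓ _ _ hadj)

/-! ### Lower bound: the growth of the combinatorial distance -/

lemma linearExtension_vertexPoint (d : V → ℕ) (v : V) :
    linearExtension d (vertexPoint v) = d v := by
  rw [linearExtension_eq_sum d (vertexPoint_mem_cell (Finset.mem_singleton_self v))]
  simp [vertexPoint]

lemma mul_linearExtension_sub_le {D : PreAbstractSimplicialComplex V}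
    (hD : IsTriangulatedSurface D) {ℓ : V → V → ℝ} {ϑ ε : ℝ} (hε : 0 < ε) (hϑ : 0 ≤ ϑ)
    (hfull : ∀ s ∈ D, IsEuclideanFull ℓ ϑ ε s) {d : V → ℕ}
    (hd : ∀ a b, (edgeGraph D).Adj a b → d a ≤ d b + 1) {s : Finset V} (hs : s ∈ D)
    {x y : V → ℝ} (hx : x ∈ cell s) (hy : y ∈ cell s) :
    ϑ * ε * (linearExtension d y - linearExtension d x) ≤ simplexDist ℓ s x y := by
  obtain ⟨t, ht, h3, hst⟩ := hD.exists_triangle hs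
  rw [simplexDist_of_subset ℓ hst hx hy]
  have hx := cell_mono hst hx
  have hy := cell_mono hst hy
  rw [linearExtension_eq_sum d hx, linearExtension_eq_sum d hy]
  refine (hfull t ht).mul_sub_le hε hϑ h3 hx hy fun a ha b hb => ?_
  by_cases hab : a = b
  · rw [hab]; exact Nat.le_succ _
  · refine hd a b ⟨hab, mem_of_subset_of_nonempty ht ?_ (by simp)⟩
    intro z hz
    simp only [Finset.mem_insert, Finset.mem_singleton] at hz
    rcases hz with rfl | rfl <;> assumption

/-- A broken line from a point of a subsurface to its boundary is at least as long as its initial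
part up to the first boundary point, along which the linear extension of `d` increases at most by
`1 / (ϑ * ε)` times the length. -/
lemma ofReal_mul_sub_linearExtension_le {M D : PreAbstractSimplicialComplex V}
    (hM : IsTriangulatedSurface M) (hD : IsTriangulatedSurface D) (hDM : D ≤ M) {ℓ : V → V → ℝ}
    {ϑ ε : ℝ} (hε : 0 < ε) (hϑ : 0 ≤ ϑ) (hfull : ∀ s ∈ D, IsEuclideanFull ℓ ϑ ε s) {d : V → ℕ}
    {m : ℕ} (hd : ∀ a b, (edgeGraph D).Adj a b → d a ≤ d b + 1)
    (hm : ∀ w, {w} ∈ boundary D → d w = m) (n : ℕ) {x y : V → ℝ} {q : ℕ → V → ℝ}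
    {s : ℕ → Finset V} (hq : IsBrokenLine M x y n q s) (hx : x ∈ realization D)
    (hy : y ∈ realization (boundary D)) :
    ENNReal.ofReal (ϑ * ε * (m - linearExtension d x)) ≤
      ∑ i ∈ Finset.range n, ENNReal.ofReal (simplexDist ℓ (s i) (q i) (q (i + 1))) := by
  induction n generalizing x q s with
  | zero =>
    have : x = y := hq.start.symm.trans hq.finish
    simp [this, linearExtension_eq_of_mem_realization hm hy]
  | succ n ih =>
    obtain rfl := hq.start
    have hl := hq.left_mem 0 n.succ_pos
    have hr := hq.right_mem 0 n.succ_pos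
    have hf := hq.face 0 n.succ_pos
    by_cases hs : s 0 ∈ D
    · have hq' : IsBrokenLine M (q 1) y n (fun i => q (i + 1)) (fun i => s (i + 1)) :=
        { mem := Set.mem_biUnion hf hr
          start := rfl
          finish := hq.finish
          face := fun i hi => hq.face _ (Nat.succ_lt_succ hi)
          left_mem := fun i hi => hq.left_mem _ (Nat.succ_lt_succ hi)
          right_mem := fun i hi => hq.right_mem _ (Nat.succ_lt_succ hi) }
      have h1 := mul_linearExtension_sub_le hD hε hϑ hfull hd hs hl hr
      rw [Finset.sum_range_succ']
      calc _ = ENNReal.ofReal (ϑ * ε * (m - linearExtension d (q 1)) +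
            ϑ * ε * (linearExtension d (q 1) - linearExtension d (q 0))) := by congr 1; ring
        _ ≤ _ := ENNReal.ofReal_add_le
        _ ≤ _ := add_le_add (ih hq' (Set.mem_biUnion hs hr)) (ENNReal.ofReal_le_ofReal h1)
    · rw [linearExtension_eq_of_mem_realization hm
        (hM.mem_realization_boundary hD hDM hx hf hs hl)]
      simp

end PiecewiseFlat
end

open PiecewiseFlat in
theorem mainTheorem7 {V : Type*} [DecidableEq V]
    (M D : PreAbstractSimplicialComplex V) (ℓ : V → V → ℝ)
    (hM : PiecewiseFlat.IsPiecewiseFlatSurface M ℓ) (hDM : D ≤ M)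
    (m : ℕ) (v : V) (hD : PiecewiseFlat.IsClosedDiskOfGeneration D m v)
    (ϑ ε : ℝ) (hfull : ∀ s ∈ D, PiecewiseFlat.IsEuclideanFull ℓ ϑ ε s)
    (δ : ENNReal)
    (hδ : δ = PiecewiseFlat.flatInfDist M ℓ (PiecewiseFlat.vertexPoint v)
      (PiecewiseFlat.realization (PiecewiseFlat.boundary D))) :
    δ ≠ ⊤ ∧ ϑ * m * ε ≤ δ.toReal ∧ δ.toReal ≤ m * ε := by
  obtain ⟨hdisk, hv, hdist⟩ := hD
  have hE : ∀ s ∈ D, IsEuclidean ℓ s := fun s hs => hM.euclidean s (hDM hs)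
  have hℓ : ∀ a b, (edgeGraph D).Adj a b → ℓ a b ≤ ε := fun a b h =>
    (hfull _ h.2).1 a (by simp) b (by simp) h.1
  have hε : 0 < ε := by
    obtain ⟨b, hb⟩ := hdisk.surface.exists_edge hv
    exact ((hE _ hb.2).length_pos (by simp) (by simp) hb.1).trans_le (hℓ v b hb)
  have hupper : δ ≤ ENNReal.ofReal (m * ε) := by
    obtain ⟨s, hs⟩ := hdisk.boundary_nonempty
    obtain ⟨w, hw⟩ := ((boundary D).isRelLowerSet_faces hs).1
    have hwb : {w} ∈ boundary D := mem_of_subset_of_nonempty hs (by simpa using hw) (by simp)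
    have hwD : {w} ∈ D := by
      obtain ⟨-, e, he, -, -, hwe⟩ := hwb
      exact mem_of_subset_of_nonempty he hwe (by simp)
    obtain ⟨p, hp⟩ := (hdisk.connected v w hv hwD).exists_walk_length_eq_dist
    rw [hdist w hwb] at hp
    rw [hδ, ENNReal.ofReal_mul m.cast_nonneg, ENNReal.ofReal_natCast, ← hp]
    exact (iInf₂_le _ (Set.mem_biUnion hwb (vertexPoint_mem_cell (by simp)))).trans
      (flatDist_le_of_walk hDM hE hℓ hv p)
  have htop : δ ≠ ⊤ := (hupper.trans_lt ENNReal.ofReal_lt_top).ne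
  refine ⟨htop, ?_, ENNReal.toReal_le_of_le_ofReal (by positivity) hupper⟩
  rcases lt_or_ge ϑ 0 with hϑ | hϑ
  · refine le_trans ?_ ENNReal.toReal_nonneg
    exact mul_nonpos_of_nonpos_of_nonneg
      (mul_nonpos_of_nonpos_of_nonneg hϑ.le m.cast_nonneg) hε.le
  rw [← ENNReal.ofReal_le_iff_le_toReal htop, hδ]
  refine le_iInf₂ fun y hy => le_iInf fun n => le_iInf fun q => le_iInf fun s => le_iInf fun hq => ?_
  have hd : ∀ a b, (edgeGraph D).Adj a b →
      (edgeGraph D).dist v a ≤ (edgeGraph D).dist v b + 1 := fun a b h => by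
    have := h.diff_dist_adj (u := v)
    omega
  have hlow := ofReal_mul_sub_linearExtension_le hM.surface hdisk.surface hDM hε hϑ hfull hd hdist n
    hq (Set.mem_biUnion hv (vertexPoint_mem_cell (by simp))) hy
  rw [linearExtension_vertexPoint, SimpleGraph.dist_self, Nat.cast_zero, sub_zero,
    mul_right_comm] at hlow
  exact hlow
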